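/- Let there be finitely many advertisers $i\in[n]$ and keywords $k\in[m]$. Advertiser $i$ is interested in a set $\Gamma(i)\subseteq[m]$ of keywords, and $\Gamma(k)=\{i : k\in\Gamma(i)\}$ is the set of advertisers interested in keyword $k$. Keyword $k$ has $|\Gamma(k)|$ positions, with click-through rates $\alpha^k_1\ge\alpha^k_2\ge\dots\ge\alpha^k_{|\Gamma(k)|}\ge 0$. Let $\mathcal A_k$ be the set of one-to-one maps $\pi_k:\Gamma(k)\hookrightarrow\{1,\dots,|\Gamma(k)|\}$ and $\Delta(\mathcal A_k)$ the set of probability distributions on $\mathcal A_k$. The AdWords polytope is the set $$P=\Big\{x\in\mathbb R^n_{\ge0} : \exists\,(\mathcal D_k)_{k\in[m]},\ \mathcal D_k\in\Delta(\mathcal A_k),\ \text{such that } x_i\le\sum_{k\in\Gamma(i)}\mathbb E_{\pi_k\sim\mathcal D_k}\big[\alpha^k_{\pi_k(i)}\big]\ \text{for all } i\in[n]\Big\}.$$ A set $Q\subseteq\mathbb R^n_{\ge 0}$ is a polymatroid if $Q=\{x\in\mathbb R^n_{\ge0} : \sum_{i\in S}x_i\le f(S)\ \text{for all } S\subseteq[n]\}$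 for some $f:2^{[n]}\to\mathbb R_{\ge0}$ that is monotone ($f(S)\le f(T)$ whenever $S\subseteq T$) and submodular ($f(S\cup T)+f(S\cap T)\le f(S)+f(T)$ for all $S,T$). **Theorem.** The AdWords polytope $P$ is a polymatroid. More precisely, the function $$f^*(S)=\sum_{k\in[m]}\ \sum_{j=1}^{|S\cap\Gamma(k)|}\alpha^k_j\qquad(S\subseteq[n])$$ is nonnegative, monotone and submodular with $f^*(\emptyset)=0$, and $$P=\Big\{x\in\mathbb R^n_{\ge0} : \sum_{i\in S}x_i\le f^*(S)\ \text{for all } S\subseteq[n]\Big\}.$$ -/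

import Mathlib

noncomputable section

/-- A nonnegative, monotone, submodular set function on the subsets of `ι`. -/
structure IsMonotoneSubmodular {ι : Type*} [DecidableEq ι] (f : Finset ι → ℝ) : Prop where
  nonneg : ∀ S, 0 ≤ f S
  monotone : ∀ S T, S ⊆ T → f S ≤ f T
  submodular : ∀ S T, f (S ∪ T) + f (S ∩ T) ≤ f S + f T

/-- The set of `x ≥ 0` with `∑_{i ∈ S} x_i ≤ f(S)` for all `S`. -/
def polymatroidOf {ι : Type*} (f : Finset ι → ℝ) : Set (ι → ℝ) :=
  {x | (∀ i, 0 ≤ x i) ∧ ∀ S : Finset ι, ∑ i ∈ S, x i ≤ f S}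

/-- A set of vectors is a polymatroid if it is cut out of the nonnegative orthant by
a nonnegative monotone submodular function. -/
def IsPolymatroid {ι : Type*} [DecidableEq ι] (P : Set (ι → ℝ)) : Prop :=
  ∃ f : Finset ι → ℝ, IsMonotoneSubmodular f ∧ P = polymatroidOf f

namespace AdWords

variable {ι κ : Type*} [Fintype ι] [DecidableEq ι] [DecidableEq κ]

/-- `Γ(k)`: the advertisers interested in keyword `k`, where `Γ i` is the set of keywords
that advertiser `i` is interested in. -/
def interested (Γ : ι → Finset κ) (k : κ) : Finset ι :=
  Finset.univ.filter fun i => k ∈ Γ i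

theorem mem_interested {Γ : ι → Finset κ} {i : ι} {k : κ} :
    i ∈ interested Γ k ↔ k ∈ Γ i := by
  simp [interested]

/-- The slots of keyword `k`: there are `|Γ(k)|` of them. -/
abbrev Slot (Γ : ι → Finset κ) (k : κ) : Type :=
  Fin (interested Γ k).card

/-- The one-to-one maps from the advertisers interested in keyword `k` to its slots. -/
abbrev Assignment (Γ : ι → Finset κ) (k : κ) : Type _ :=
  {i // i ∈ interested Γ k} ↪ Slot Γ k

/-- The expected number of clicks that advertiser `i` gets from keyword `k` when the
assignment `π` is drawn with probability `D π`: the expectation of `α_{π(i)}`. -/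
def expectedClicks (Γ : ι → Finset κ) (k : κ) (α : Slot Γ k → ℝ)
    (D : Assignment Γ k → ℝ) (i : {i // i ∈ interested Γ k}) : ℝ :=
  ∑ π : Assignment Γ k, D π * α (π i)

/-- The AdWords polytope: the nonnegative click vectors `x` for which there are, for each
keyword `k`, a probability distribution `D k` over the assignments for `k` such that each
`x i` is at most the expected number of clicks of `i` summed over the keywords in `Γ i`. -/
def polytope (Γ : ι → Finset κ) (α : (k : κ) → Slot Γ k → ℝ) : Set (ι → ℝ) :=
  {x | (∀ i, 0 ≤ x i) ∧
    ∃ D : (k : κ) → Assignment Γ k → ℝ,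
      (∀ k, D k ∈ stdSimplex ℝ (Assignment Γ k)) ∧
      ∀ i, x i ≤ ∑ k ∈ (Γ i).attach,
        expectedClicks Γ k.1 (α k.1) (D k.1) ⟨i, mem_interested.2 k.2⟩}

/-- `f*(S) = ∑_k ∑_{j ≤ |S ∩ Γ(k)|} α^k_j`; slots are numbered from `0` here, so that the
first `|S ∩ Γ(k)|` slots are those with `j < |S ∩ Γ(k)|`. -/
def rankFunction [Fintype κ] (Γ : ι → Finset κ) (α : (k : κ) → Slot Γ k → ℝ)
    (S : Finset ι) : ℝ :=
  ∑ k : κ, ∑ j : Slot Γ k with j.val < (S ∩ interested Γ k).card, α k j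

end AdWords

end

/-! An injective assignment sends `S ∩ Γ(k)` to that many distinct slots, worth at most the top
ones; averaging gives `P ⊆ polymatroidOf f*`. Conversely, a point of the polymatroid that is not
dominated by any click vector is strictly separated from the closed convex set of dominated vectors
by a functional `w`, which is nonnegative as that set is closed downwards. Greedy assignment by
decreasing `w` attains `f*` on every superlevel set of `w` (`exists_totalClicks_superlevel`), so
`Finset.sum_mul_nonneg_of_superlevel` gives it at least the `w`-value of the point, a contradiction.
-/

/-- The sum of an antitone sequence over a finite set of indices is at most the sum of its
initial segment of the same length. -/
theorem Antitone.sum_le_sum_range_card {β : ℕ → ℝ} (hβ : Antitone β) (T : Finset ℕ) :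
    ∑ j ∈ T, β j ≤ ∑ j ∈ Finset.range T.card, β j := by
  induction T using Finset.induction_on_max with
  | empty => simp
  | insert a s ha ih =>
    have hmem : a ∉ s := fun h => lt_irrefl a (ha a h)
    have hcard : s.card ≤ a := by
      simpa using Finset.card_le_card (fun x hx => Finset.mem_range.2 (ha x hx) :
        s ⊆ Finset.range a)
    rw [Finset.sum_insert hmem, Finset.card_insert_of_notMem hmem, Finset.sum_range_succ,
      add_comm]
    exact add_le_add ih (hβ hcard)

/-- The partial sums of an antitone sequence are concave. -/
theorem Antitone.sum_range_add_sum_range_le {β : ℕ → ℝ} (hβ : Antitone β) {a b c d : ℕ}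
    (hab : a ≤ b) (hac : a ≤ c) (h : d + a = b + c) :
    ∑ j ∈ Finset.range d, β j + ∑ j ∈ Finset.range a, β j ≤
      ∑ j ∈ Finset.range b, β j + ∑ j ∈ Finset.range c, β j := by
  obtain ⟨p, rfl⟩ := Nat.exists_eq_add_of_le hab
  obtain ⟨q, rfl⟩ := Nat.exists_eq_add_of_le hac
  obtain rfl : d = a + p + q := by omega
  rw [Finset.sum_range_add β (a + p) q, Finset.sum_range_add β a q]
  have : ∑ x ∈ Finset.range q, β (a + p + x) ≤ ∑ x ∈ Finset.range q, β (a + x) :=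
    Finset.sum_le_sum fun x _ => hβ (by omega)
  linarith

/-- If all superlevel sets of a nonnegative weight `w` have nonnegative `d`-sum, then the
`w`-weighted sum of `d` is nonnegative. -/
theorem Finset.sum_mul_nonneg_of_superlevel {ι : Type*} [DecidableEq ι] (s : Finset ι)
    (w d : ι → ℝ) (hw : ∀ i ∈ s, 0 ≤ w i)
    (h : ∀ t : ℝ, 0 ≤ ∑ i ∈ s with t ≤ w i, d i) : 0 ≤ ∑ i ∈ s, w i * d i := by
  induction s using Finset.strongInduction generalizing w with
  | H s ih =>
    rcases s.eq_empty_or_nonempty with rfl | hs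
    · simp
    obtain ⟨i₀, hi₀, hmin⟩ := s.exists_min_image w hs
    -- Abel summation: peel off the least weight, leaving a shifted weight on a strictly smaller
    -- set.
    have hsplit : ∑ i ∈ s, w i * d i
        = w i₀ * ∑ i ∈ s, d i + ∑ i ∈ s with w i₀ < w i, (w i - w i₀) * d i := by
      rw [Finset.sum_filter_of_ne, Finset.mul_sum, ← Finset.sum_add_distrib]
      · exact Finset.sum_congr rfl fun i _ => by ring
      · intro i hi hne
        refine lt_of_le_of_ne (hmin i hi) fun heq => hne ?_
        rw [heq, sub_self, zero_mul]
    have htotal : 0 ≤ ∑ i ∈ s, d i := by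
      simpa only [Finset.filter_true_of_mem hmin] using h (w i₀)
    have hrest : 0 ≤ ∑ i ∈ s with w i₀ < w i, (w i - w i₀) * d i := by
      refine ih _ ?_ (fun i => w i - w i₀) ?_ ?_
      · exact Finset.filter_ssubset.2 ⟨i₀, hi₀, lt_irrefl _⟩
      · intro i hi
        exact sub_nonneg.2 (Finset.mem_filter.1 hi).2.le
      · intro t
        rw [Finset.filter_filter]
        rcases le_or_gt t 0 with ht | ht
        -- For `t ≤ 0` the level condition is vacuous; what remains is the superlevel set at the
        -- second smallest value of `w`.
        · by_cases hne : (s.filter fun i => w i₀ < w i).Nonempty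
          · obtain ⟨i₁, hi₁, hmin₁⟩ := Finset.exists_min_image _ w hne
            have hi₁' := (Finset.mem_filter.1 hi₁).2
            have heq : (s.filter fun i => w i₀ < w i ∧ t ≤ w i - w i₀)
                = s.filter fun i => w i₁ ≤ w i := by
              refine Finset.filter_congr fun i hi => ⟨fun hlt => ?_, fun hle => ?_⟩
              · exact hmin₁ i (Finset.mem_filter.2 ⟨hi, hlt.1⟩)
              · constructor <;> linarith
            rw [heq]
            exact h _
          · rw [Finset.not_nonempty_iff_eq_empty] at hne
            rw [← Finset.filter_filter, hne]
            simp
        · have heq : (s.filter fun i => w i₀ < w i ∧ t ≤ w i - w i₀)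
              = s.filter fun i => t + w i₀ ≤ w i :=
            Finset.filter_congr fun i _ =>
              ⟨fun hlt => by linarith [hlt.2], fun hle => by constructor <;> linarith⟩
          rw [heq]
          exact h _
    rw [hsplit]
    exact add_nonneg (mul_nonneg (hw i₀ hi₀) htotal) hrest

/-- A lower set of `Fin n` is the initial segment of its cardinality. -/
theorem Finset.eq_filter_lt_card_of_isLowerSet {n : ℕ} (L : Finset (Fin n))
    (hL : IsLowerSet (L : Set (Fin n))) :
    L = Finset.univ.filter fun j : Fin n => j.val < L.card := by
  refine Finset.eq_of_subset_of_card_le (fun j hj => ?_) ?_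
  · have hsub : Finset.Iic j ⊆ L := fun a ha => hL (Finset.mem_Iic.1 ha) hj
    have hcard := Finset.card_le_card hsub
    rw [Fin.card_Iic] at hcard
    simpa using hcard
  · have hcard := Finset.card_le_card_of_injOn (s := Finset.univ.filter fun j : Fin n =>
      j.val < L.card) (t := Finset.range L.card) Fin.val (by intro j; simp) Fin.val_injective.injOn
    simpa using hcard

/-- The elements of a finite type can be enumerated by weakly decreasing weight. -/
theorem exists_equiv_fin_antitone {σ : Type*} (n : ℕ) (e : σ ≃ Fin n) (w : σ → ℝ) :
    ∃ π : σ ≃ Fin n, Antitone (w ∘ π.symm) := by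
  refine ⟨e.trans (Tuple.sort fun j => -w (e.symm j)).symm, fun a b hab => ?_⟩
  have := Tuple.monotone_sort (fun j => -w (e.symm j)) hab
  simpa using this

/-- A tuple of reals extended by zero to a sequence. -/
noncomputable def Fin.extendZero {n : ℕ} (a : Fin n → ℝ) (j : ℕ) : ℝ :=
  if h : j < n then a ⟨j, h⟩ else 0

namespace Fin

variable {n : ℕ} {a : Fin n → ℝ}

theorem extendZero_val (a : Fin n → ℝ) (j : Fin n) : extendZero a j = a j := by
  simp [extendZero]

theorem extendZero_nonneg (h0 : ∀ j, 0 ≤ a j) (j : ℕ) : 0 ≤ extendZero a j := by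
  unfold extendZero
  split_ifs
  exacts [h0 _, le_rfl]

/-- Nonnegativity keeps the step down to the zero tail decreasing. -/
theorem antitone_extendZero (h0 : ∀ j, 0 ≤ a j) (ha : Antitone a) :
    Antitone (extendZero a) := by
  intro i j hij
  by_cases hj : j < n
  · simp only [extendZero, hj, hij.trans_lt hj, dif_pos]
    exact ha hij
  · rw [extendZero, dif_neg hj]
    exact extendZero_nonneg h0 i

theorem sum_eq_sum_map_extendZero (a : Fin n → ℝ) (T : Finset (Fin n)) :
    ∑ j ∈ T, a j = ∑ j ∈ T.map Fin.valEmbedding, extendZero a j := by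
  simp [extendZero_val]

theorem sum_filter_lt_eq_sum_range (a : Fin n → ℝ) (c : ℕ) :
    ∑ j : Fin n with j.val < c, a j = ∑ j ∈ Finset.range c, extendZero a j := by
  rw [sum_eq_sum_map_extendZero]
  refine Finset.sum_subset (fun j hj => ?_) fun j hj hj' => ?_
  · obtain ⟨i, hi, rfl⟩ := Finset.mem_map.1 hj
    simpa using hi
  · refine dif_neg fun hn => hj' (Finset.mem_map.2 ⟨⟨j, hn⟩, ?_, rfl⟩)
    simpa using hj

theorem sum_le_sum_filter_lt_card (h0 : ∀ j, 0 ≤ a j) (ha : Antitone a)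
    (T : Finset (Fin n)) : ∑ j ∈ T, a j ≤ ∑ j : Fin n with j.val < T.card, a j := by
  rw [sum_filter_lt_eq_sum_range, sum_eq_sum_map_extendZero]
  simpa using (antitone_extendZero h0 ha).sum_le_sum_range_card (T.map Fin.valEmbedding)

end Fin

namespace AdWords

variable {ι κ : Type*} [Fintype ι] [DecidableEq ι] [DecidableEq κ]

/-! ### Submodularity of the rank function -/

theorem isMonotoneSubmodular_rankFunction [Fintype κ] (Γ : ι → Finset κ)
    (α : (k : κ) → Slot Γ k → ℝ) (h0 : ∀ k j, 0 ≤ α k j) (ha : ∀ k, Antitone (α k)) :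
    IsMonotoneSubmodular (rankFunction Γ α) where
  nonneg S := Finset.sum_nonneg fun k _ => Finset.sum_nonneg fun j _ => h0 k j
  monotone S T hST := by
    refine Finset.sum_le_sum fun k _ => ?_
    refine Finset.sum_le_sum_of_subset_of_nonneg (fun j hj => ?_) fun j _ _ => h0 k j
    have hcard := Finset.card_le_card (Finset.inter_subset_inter_right (u := interested Γ k) hST)
    simp only [Finset.mem_filter, Finset.mem_univ, true_and] at hj ⊢
    exact hj.trans_le hcard
  submodular S T := by
    simp only [rankFunction, ← Finset.sum_add_distrib]
    refine Finset.sum_le_sum fun k _ => ?_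
    -- Each summand is a concave function of the modular count `|S ∩ Γ(k)|`.
    simp only [Fin.sum_filter_lt_eq_sum_range]
    refine (Fin.antitone_extendZero (h0 k) (ha k)).sum_range_add_sum_range_le ?_ ?_ ?_
    · exact Finset.card_le_card (Finset.inter_subset_inter_right Finset.inter_subset_left)
    · exact Finset.card_le_card (Finset.inter_subset_inter_right Finset.inter_subset_right)
    · rw [Finset.union_inter_distrib_right, Finset.inter_inter_distrib_right]
      exact Finset.card_union_add_card_inter _ _

/-! ### Click vectors satisfy the rank inequalities -/

/-- The expected clicks of each advertiser over all keywords, as a linear function of the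
distributions over assignments. -/
noncomputable def totalClicks (Γ : ι → Finset κ) (α : (k : κ) → Slot Γ k → ℝ) :
    ((k : κ) → Assignment Γ k → ℝ) →ₗ[ℝ] (ι → ℝ) where
  toFun D i := ∑ k ∈ (Γ i).attach,
    expectedClicks Γ k.1 (α k.1) (D k.1) ⟨i, mem_interested.2 k.2⟩
  map_add' D D' := by
    ext i
    simp [expectedClicks, add_mul, Finset.sum_add_distrib]
  map_smul' c D := by
    ext i
    simp [expectedClicks, mul_assoc, Finset.mul_sum]

theorem totalClicks_apply (Γ : ι → Finset κ) (α : (k : κ) → Slot Γ k → ℝ)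
    (D : (k : κ) → Assignment Γ k → ℝ) (i : ι) :
    totalClicks Γ α D i = ∑ k ∈ (Γ i).attach,
      expectedClicks Γ k.1 (α k.1) (D k.1) ⟨i, mem_interested.2 k.2⟩ := rfl

theorem sum_totalClicks [Fintype κ] (Γ : ι → Finset κ) (α : (k : κ) → Slot Γ k → ℝ)
    (D : (k : κ) → Assignment Γ k → ℝ) (S : Finset ι) :
    ∑ i ∈ S, totalClicks Γ α D i =
      ∑ k, ∑ i : {i // i ∈ interested Γ k} with i.1 ∈ S, expectedClicks Γ k (α k) (D k) i := by
  have hleft (i : ι) : totalClicks Γ α D i = ∑ k, if h : i ∈ interested Γ k then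
      expectedClicks Γ k (α k) (D k) ⟨i, h⟩ else 0 := by
    rw [totalClicks_apply, ← Finset.sum_subset (Finset.subset_univ (Γ i)),
      ← Finset.sum_attach (Γ i)]
    · exact Finset.sum_congr rfl fun k _ => by rw [dif_pos (mem_interested.2 k.2)]
    · intro k _ hk
      exact dif_neg (mt mem_interested.1 hk)
  have hright (k : κ) : ∑ i : {i // i ∈ interested Γ k} with i.1 ∈ S,
      expectedClicks Γ k (α k) (D k) i = ∑ i ∈ S, if h : i ∈ interested Γ k then
        expectedClicks Γ k (α k) (D k) ⟨i, h⟩ else 0 := by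
    refine Finset.sum_bij_ne_zero (fun i _ _ => i.1) ?_ ?_ ?_ ?_
    · intro i hi _
      exact (Finset.mem_filter.1 hi).2
    · intro i _ _ j _ _ hij
      exact Subtype.ext hij
    · intro i hi hne
      by_cases h : i ∈ interested Γ k
      · rw [dif_pos h] at hne
        exact ⟨⟨i, h⟩, by simpa using hi, hne, rfl⟩
      · exact absurd (dif_neg h) hne
    · intro i _ _
      rw [dif_pos i.2]
  simp only [hleft, hright]
  exact Finset.sum_comm

theorem card_map_filter_mem (Γ : ι → Finset κ) (k : κ) (π : Assignment Γ k) (S : Finset ι) :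
    ((Finset.univ.filter fun i : {i // i ∈ interested Γ k} => i.1 ∈ S).map π).card
      = (S ∩ interested Γ k).card := by
  rw [Finset.card_map, ← Finset.card_map (Function.Embedding.subtype _)]
  congr 1
  ext i
  simp [and_comm]

theorem sum_expectedClicks_le (Γ : ι → Finset κ) (k : κ) (a : Slot Γ k → ℝ)
    (h0 : ∀ j, 0 ≤ a j) (ha : Antitone a) (D : Assignment Γ k → ℝ)
    (hD : D ∈ stdSimplex ℝ (Assignment Γ k)) (S : Finset ι) :
    ∑ i : {i // i ∈ interested Γ k} with i.1 ∈ S, expectedClicks Γ k a D i ≤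
      ∑ j : Slot Γ k with j.val < (S ∩ interested Γ k).card, a j := by
  unfold expectedClicks
  rw [Finset.sum_comm]
  calc _ ≤ ∑ π : Assignment Γ k,
        D π * ∑ j : Slot Γ k with j.val < (S ∩ interested Γ k).card, a j := by
        refine Finset.sum_le_sum fun π _ => ?_
        rw [← Finset.mul_sum]
        refine mul_le_mul_of_nonneg_left ?_ (hD.1 π)
        rw [← Finset.sum_map _ π a, ← card_map_filter_mem Γ k π S]
        exact Fin.sum_le_sum_filter_lt_card h0 ha _
    _ = _ := by rw [← Finset.sum_mul, hD.2, one_mul]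

theorem polytope_subset_polymatroidOf [Fintype κ] (Γ : ι → Finset κ)
    (α : (k : κ) → Slot Γ k → ℝ) (h0 : ∀ k j, 0 ≤ α k j) (ha : ∀ k, Antitone (α k)) :
    polytope Γ α ⊆ polymatroidOf (rankFunction Γ α) := by
  rintro x ⟨hx, D, hD, hxD⟩
  refine ⟨hx, fun S => ?_⟩
  calc ∑ i ∈ S, x i ≤ ∑ i ∈ S, totalClicks Γ α D i := Finset.sum_le_sum fun i _ => hxD i
    _ ≤ rankFunction Γ α S := by
      rw [sum_totalClicks]
      exact Finset.sum_le_sum fun k _ =>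
        sum_expectedClicks_le Γ k (α k) (h0 k) (ha k) (D k) (hD k) S

/-! ### Greedy assignments and separation -/

/-- Assigning the slots of keyword `k` by decreasing weight gives every superlevel set of the
weight the best slots. -/
theorem exists_assignment_superlevel (Γ : ι → Finset κ) (k : κ) (a : Slot Γ k → ℝ)
    (w : ι → ℝ) :
    ∃ π : Assignment Γ k, ∀ t : ℝ, ∀ S : Finset ι, (∀ i, i ∈ S ↔ t ≤ w i) →
      ∑ i : {i // i ∈ interested Γ k} with i.1 ∈ S, a (π i) =
        ∑ j : Slot Γ k with j.val < (S ∩ interested Γ k).card, a j := by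
  obtain ⟨e, he⟩ := exists_equiv_fin_antitone _ (interested Γ k).equivFin fun i => w i.1
  refine ⟨e.toEmbedding, fun t S hS => ?_⟩
  rw [← card_map_filter_mem Γ k e.toEmbedding S, ← Finset.eq_filter_lt_card_of_isLowerSet,
    Finset.sum_map]
  intro b c hcb hb
  simp only [Finset.coe_map, Set.mem_image, Finset.mem_coe, Finset.mem_filter,
    Finset.mem_univ, true_and, hS] at hb ⊢
  obtain ⟨i, hi, rfl⟩ := hb
  refine ⟨e.symm c, hi.trans ?_, by simp⟩
  simpa using he hcb

/-- For every weight there are distributions whose total clicks are tight on all superlevel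
sets of the weight. -/
theorem exists_totalClicks_superlevel [Fintype κ] (Γ : ι → Finset κ)
    (α : (k : κ) → Slot Γ k → ℝ) (w : ι → ℝ) :
    ∃ D : (k : κ) → Assignment Γ k → ℝ, (∀ k, D k ∈ stdSimplex ℝ (Assignment Γ k)) ∧
      ∀ t : ℝ, ∀ S : Finset ι, (∀ i, i ∈ S ↔ t ≤ w i) →
        ∑ i ∈ S, totalClicks Γ α D i = rankFunction Γ α S := by
  classical
  choose π hπ using fun k => exists_assignment_superlevel Γ k (α k) w
  -- Point masses at the greedy assignments.
  refine ⟨fun k => Pi.single (π k) 1, fun k => single_mem_stdSimplex ℝ _, fun t S hS => ?_⟩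
  rw [sum_totalClicks]
  refine Finset.sum_congr rfl fun k _ => ?_
  rw [← hπ k t S hS]
  refine Finset.sum_congr rfl fun i _ => ?_
  simp [expectedClicks, Pi.single_apply]

open scoped Pointwise in
/-- The vectors dominated by the total clicks of some distributions over assignments. -/
def dominated (Γ : ι → Finset κ) (α : (k : κ) → Slot Γ k → ℝ) : Set (ι → ℝ) :=
  totalClicks Γ α '' (Set.univ.pi fun k => stdSimplex ℝ (Assignment Γ k)) + (Set.Iic 0 : Set (ι → ℝ))

theorem mem_dominated {Γ : ι → Finset κ} {α : (k : κ) → Slot Γ k → ℝ} {x : ι → ℝ} :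
    x ∈ dominated Γ α ↔ ∃ D : (k : κ) → Assignment Γ k → ℝ,
      (∀ k, D k ∈ stdSimplex ℝ (Assignment Γ k)) ∧ x ≤ totalClicks Γ α D := by
  constructor
  · rintro ⟨_, ⟨D, hD, rfl⟩, z, hz, rfl⟩
    exact ⟨D, fun k => hD k trivial, add_le_of_nonpos_right hz⟩
  · rintro ⟨D, hD, hx⟩
    exact ⟨_, ⟨D, fun k _ => hD k, rfl⟩, x - totalClicks Γ α D, sub_nonpos.2 hx,
      add_sub_cancel _ _⟩

theorem convex_dominated (Γ : ι → Finset κ) (α : (k : κ) → Slot Γ k → ℝ) :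
    Convex ℝ (dominated Γ α) :=
  ((convex_pi fun _ _ => convex_stdSimplex ℝ _).linear_image _).add (convex_Iic 0)

/-- A compact set plus a closed one is closed. -/
theorem isClosed_dominated [Fintype κ] (Γ : ι → Finset κ) (α : (k : κ) → Slot Γ k → ℝ) :
    IsClosed (dominated Γ α) :=
  isClosed_Iic.add_left_of_isCompact
    ((isCompact_univ_pi fun _ => isCompact_stdSimplex ℝ _).image
      (totalClicks Γ α).continuous_of_finiteDimensional)

theorem polymatroidOf_subset_dominated [Fintype κ] (Γ : ι → Finset κ)
    (α : (k : κ) → Slot Γ k → ℝ) :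
    polymatroidOf (rankFunction Γ α) ⊆ dominated Γ α := by
  rintro x ⟨-, hx⟩
  by_contra hnot
  obtain ⟨l, u, hlt, hgt⟩ := geometric_hahn_banach_closed_point (convex_dominated Γ α)
    (isClosed_dominated Γ α) hnot
  set w : ι → ℝ := fun i => l (Pi.single i 1) with hw
  obtain ⟨D, hD, htight⟩ := exists_totalClicks_superlevel Γ α w
  have hmem := hlt _ (mem_dominated.2 ⟨D, hD, le_rfl⟩)
  have hw0 (i : ι) : 0 ≤ w i := by
    by_contra! hneg
    -- Lowering coordinate `i` by this `r` raises `l` to exactly `u`, while staying in the dominated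
    -- set.
    set r := (u - l (totalClicks Γ α D)) / (-w i) with hr
    have hr0 : 0 ≤ r := div_nonneg (by linarith) (by linarith)
    have hlow := hlt (totalClicks Γ α D - r • Pi.single i 1)
      (mem_dominated.2 ⟨D, hD, sub_le_self _ (smul_nonneg hr0 (Pi.single_nonneg.2 zero_le_one))⟩)
    have hrw : r * w i = -(u - l (totalClicks Γ α D)) := by
      rw [hr]
      field_simp [hneg.ne]
    rw [map_sub, map_smul, smul_eq_mul] at hlow
    change _ - r * w i < u at hlow
    linarith
  have hnonneg : 0 ≤ ∑ i, w i * (totalClicks Γ α D i - x i) := by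
    refine Finset.sum_mul_nonneg_of_superlevel _ _ _ (fun i _ => hw0 i) fun t => ?_
    rw [Finset.sum_sub_distrib, htight t _ (by simp)]
    exact sub_nonneg.2 (hx _)
  have hl : l (totalClicks Γ α D - x) = ∑ i, w i * (totalClicks Γ α D i - x i) := by
    have := l.toLinearMap.pi_apply_eq_sum_univ (totalClicks Γ α D - x)
    refine this.trans (Finset.sum_congr rfl fun i _ => ?_)
    have hsingle : (fun j => if i = j then (1 : ℝ) else 0) = Pi.single i 1 := by
      ext j
      simp [Pi.single_apply, eq_comm]
    rw [hsingle, smul_eq_mul, mul_comm]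
    rfl
  rw [map_sub] at hl
  -- The contradiction is `l x ≤ l (totalClicks Γ α D) < u < l x`.
  linarith

theorem polytope_eq_polymatroidOf [Fintype κ] (Γ : ι → Finset κ)
    (α : (k : κ) → Slot Γ k → ℝ) (h0 : ∀ k j, 0 ≤ α k j) (ha : ∀ k, Antitone (α k)) :
    polytope Γ α = polymatroidOf (rankFunction Γ α) := by
  refine (polytope_subset_polymatroidOf Γ α h0 ha).antisymm fun x hx => ⟨hx.1, ?_⟩
  exact mem_dominated.1 (polymatroidOf_subset_dominated Γ α hx)

end AdWords

theorem mainTheorem2 {ι κ : Type*} [Fintype ι] [DecidableEq ι] [Fintype κ] [DecidableEq κ]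
    (Γ : ι → Finset κ) (α : (k : κ) → AdWords.Slot Γ k → ℝ)
    (hα_nonneg : ∀ k j, 0 ≤ α k j) (hα_anti : ∀ k, Antitone (α k)) :
    IsPolymatroid (AdWords.polytope Γ α) ∧
    IsMonotoneSubmodular (AdWords.rankFunction Γ α) ∧
    AdWords.rankFunction Γ α ∅ = 0 ∧
    AdWords.polytope Γ α = polymatroidOf (AdWords.rankFunction Γ α) := by
  have hsub := AdWords.isMonotoneSubmodular_rankFunction Γ α hα_nonneg hα_anti
  have heq := AdWords.polytope_eq_polymatroidOf Γ α hα_nonneg hα_anti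
  exact ⟨⟨_, hsub, heq⟩, hsub, by simp [AdWords.rankFunction], heq⟩
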